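/- Throughout, "subspace" of a Banach space means linear subspace, $[A]$ is the closed linear span of $A$, and $\mathbf B_X$ is the closed unit ball. A real Banach space $X$ satisfies $(\mathcal B)$ if for every uncountable regular cardinal $\mu$ and every decreasing sequence $\{Z_\alpha\}_{\alpha<\mu}$ of closed subspaces of $X$ with $\bigcap_{\alpha<\mu}Z_\alpha=\{0\}$ the set $\bigcap_{\alpha<\mu}\overline{\mathbf B_X+Z_\alpha}$ is bounded; it satisfies $(1\text{-}\mathcal B)$ if this set is always contained in $\mathbf B_X$. A sequence $\{x_\alpha\}_{\alpha<\kappa}\subset X$ is generating if $[x_\alpha:\alpha<\kappa]=X$, and strongly dispersed if $\bigcap_{\gamma<\kappa}[x_\alpha:\gamma<\alpha<\kappa]=\{0\}$ and $[x_\alpha:\beta<\alpha<\kappa]\neq\{0\}$ for every $\beta<\kappa$. It is an M-basis if it is generating and there are $x_\alpha^*\in X^*$ with $x_\alpha^*(x_\beta)=\delta_{\alpha,\beta}$ whose linear span is weak$^*$ dense in $X^*$. $X$ has the SCP (resp. $1$-SCP) if each separable subspace of $X$ is contained in a separable subspace that is the range of a bounded linear projection on $X$ (resp. one of norm at most $1$).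 For a closed subspace $Z\subset X$, $\mathrm{codens}(Z)$ is the density character (least cardinality of a dense subset) of $X/Z$. Subsequences are strictly increasing, of arbitrary ordinal length. Theorem. Let $X$ be a real Banach space satisfying $(\mathcal B)$, let $\kappa$ be an uncountable regular cardinal, and let $\{x_\alpha\}_{\alpha<\kappa}$ be a generating strongly dispersed sequence in $X$. (i) If $\kappa=\omega_1$, then $X$ has the SCP. (ii) If $\kappa<\aleph_\omega$ and $\{x_\alpha\}_{\alpha<\kappa}$ is an M-basis, then $X$ has the SCP. (iii) If $\kappa=\aleph_k$ with $0<k<\omega$ and $Y\subset X$ is a separable subspace, then there are a closed subspace $Z\subset X$ with $\mathrm{codens}(Z)\le\aleph_{k-1}$ and a closed separable subspace $W$ with $Y\subset W\subset Z$ such that $W$ is the range of a bounded linear projection on $Z$. If in (i) or (ii) $X$ satisfies in addition $(1\text{-}\mathcal B)$, then $X$ has the $1$-SCP. In all cases the complemented subspaces (the separable superspaces in the SCP and the $1$-SCP in (i) and (ii), and $W$ in (iii)) can be chosen to be closed linear spans of subsequences of $\{x_\alpha\}_{\alpha<\kappa}$. -/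

import Mathlib

open scoped Cardinal

universe u

/-- `[A]`: the closed linear span of `A`. -/
def closedSpan {X : Type u} [NormedAddCommGroup X] [NormedSpace ℝ X] (A : Set X) :
    Submodule ℝ X :=
  (Submodule.span ℝ A).topologicalClosure

/-- The tail `[x_α : β < α < o]` of a sequence of length `o`. -/
def tailSpan {X : Type u} [NormedAddCommGroup X] [NormedSpace ℝ X] {o : Ordinal.{u}}
    (x : Set.Iio o → X) (β : Set.Iio o) : Submodule ℝ X :=
  closedSpan (x '' Set.Ioi β)

/-- `x` is dispersed: the intersection of all tails is strictly smaller than each tail. -/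
def IsDispersed {X : Type u} [NormedAddCommGroup X] [NormedSpace ℝ X] {o : Ordinal.{u}}
    (x : Set.Iio o → X) : Prop :=
  ∀ β : Set.Iio o, (⨅ γ, tailSpan x γ) < tailSpan x β

/-- `x` is strongly dispersed: dispersed, and the tails intersect in `{0}`. -/
def IsStronglyDispersed {X : Type u} [NormedAddCommGroup X] [NormedSpace ℝ X] {o : Ordinal.{u}}
    (x : Set.Iio o → X) : Prop :=
  IsDispersed x ∧ (⨅ γ, tailSpan x γ) = ⊥

/-- `x` is generating: its closed linear span is the whole space. -/
def IsGenerating {X : Type u} [NormedAddCommGroup X] [NormedSpace ℝ X] {o : Ordinal.{u}}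
    (x : Set.Iio o → X) : Prop :=
  closedSpan (Set.range x) = ⊤

/-- `x` is a Markushevich basis: it is generating and has biorthogonal functionals whose
linear span is weak-star dense in the dual. -/
def IsMBasis {X : Type u} [NormedAddCommGroup X] [NormedSpace ℝ X] {o : Ordinal.{u}}
    (x : Set.Iio o → X) : Prop :=
  IsGenerating x ∧ ∃ f : Set.Iio o → StrongDual ℝ X,
    (∀ α, f α (x α) = 1) ∧ (∀ α β, α ≠ β → f α (x β) = 0) ∧
    (Submodule.span ℝ
      (Set.range fun α => StrongDual.toWeakDual (f α))).topologicalClosure = ⊤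

/-- `Z` is a nested (decreasing) sequence of closed linear subspaces with intersection `{0}`. -/
def IsNullChain {X : Type u} [NormedAddCommGroup X] [NormedSpace ℝ X] {o : Ordinal.{u}}
    (Z : Set.Iio o → Submodule ℝ X) : Prop :=
  Antitone Z ∧ (∀ α, IsClosed (Z α : Set X)) ∧ (⨅ α, Z α) = ⊥

/-- The intersection over `α` of the closures of `B_X + Z_α`. -/
def ballHull {X : Type u} [NormedAddCommGroup X] [NormedSpace ℝ X] {o : Ordinal.{u}}
    (Z : Set.Iio o → Submodule ℝ X) : Set X :=
  ⋂ α, closure {v : X | ∃ b ∈ Metric.closedBall (0 : X) 1, ∃ z ∈ Z α, v = b + z}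

/-- Condition (B). -/
def ConditionB (X : Type u) [NormedAddCommGroup X] [NormedSpace ℝ X] : Prop :=
  ∀ μ : Cardinal.{u}, μ.IsRegular → ℵ₀ < μ →
    ∀ Z : Set.Iio μ.ord → Submodule ℝ X, IsNullChain Z → Bornology.IsBounded (ballHull Z)

/-- Condition (r-B). -/
def ConditionRB (r : ℝ) (X : Type u) [NormedAddCommGroup X] [NormedSpace ℝ X] : Prop :=
  ∀ μ : Cardinal.{u}, μ.IsRegular → ℵ₀ < μ →
    ∀ Z : Set.Iio μ.ord → Submodule ℝ X, IsNullChain Z →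
      ballHull Z ⊆ Metric.closedBall (0 : X) r

/-- `W` is 1-complemented: it is the range of a linear projection of norm at most one. -/
def IsOneComplemented {X : Type u} [NormedAddCommGroup X] [NormedSpace ℝ X]
    (W : Submodule ℝ X) : Prop :=
  ∃ P : X →L[ℝ] W, (∀ w : W, P w = w) ∧ ‖P‖ ≤ 1

/-- `W` is contained in `Z` and complemented in `Z`. -/
def IsComplementedIn {X : Type u} [NormedAddCommGroup X] [NormedSpace ℝ X]
    (W Z : Submodule ℝ X) : Prop :=
  W ≤ Z ∧ (W.submoduleOf Z).ClosedComplemented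

/-- `W` is the closed linear span of a (strictly increasing) subsequence of `x`, of any ordinal
length. -/
def IsGeneratedBySubseq {X : Type u} [NormedAddCommGroup X] [NormedSpace ℝ X] {o : Ordinal.{u}}
    (x : Set.Iio o → X) (W : Submodule ℝ X) : Prop :=
  ∃ (l : Ordinal.{u}) (φ : Set.Iio l → Set.Iio o), StrictMono φ ∧
    W = closedSpan (Set.range fun σ => x (φ σ))

/-- The separable complementation property. -/
def HasSCP (X : Type u) [NormedAddCommGroup X] [NormedSpace ℝ X] : Prop :=
  ∀ Y : Submodule ℝ X, TopologicalSpace.IsSeparable (Y : Set X) →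
    ∃ W : Submodule ℝ X, Y ≤ W ∧ TopologicalSpace.IsSeparable (W : Set X) ∧
      W.ClosedComplemented

/-- The 1-separable complementation property. -/
def HasOneSCP (X : Type u) [NormedAddCommGroup X] [NormedSpace ℝ X] : Prop :=
  ∀ Y : Submodule ℝ X, TopologicalSpace.IsSeparable (Y : Set X) →
    ∃ W : Submodule ℝ X, Y ≤ W ∧ TopologicalSpace.IsSeparable (W : Set X) ∧
      IsOneComplemented W

/-- The separable complementation property, with complemented subspaces generated by
subsequences of `x`. -/
def HasSCPVia {X : Type u} [NormedAddCommGroup X] [NormedSpace ℝ X] {o : Ordinal.{u}}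
    (x : Set.Iio o → X) : Prop :=
  ∀ Y : Submodule ℝ X, TopologicalSpace.IsSeparable (Y : Set X) →
    ∃ W : Submodule ℝ X, Y ≤ W ∧ TopologicalSpace.IsSeparable (W : Set X) ∧
      W.ClosedComplemented ∧ IsGeneratedBySubseq x W

/-- The 1-separable complementation property, with 1-complemented subspaces generated by
subsequences of `x`. -/
def HasOneSCPVia {X : Type u} [NormedAddCommGroup X] [NormedSpace ℝ X] {o : Ordinal.{u}}
    (x : Set.Iio o → X) : Prop :=
  ∀ Y : Submodule ℝ X, TopologicalSpace.IsSeparable (Y : Set X) →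
    ∃ W : Submodule ℝ X, Y ≤ W ∧ TopologicalSpace.IsSeparable (W : Set X) ∧
      IsOneComplemented W ∧ IsGeneratedBySubseq x W

/-- The density character: the least cardinality of a dense subset. -/
noncomputable def densChar (T : Type u) [TopologicalSpace T] : Cardinal.{u} :=
  sInf {c | ∃ s : Set T, Dense s ∧ #s = c}

/-- `codens(Z)`: the density character of the quotient `X / Z`. -/
noncomputable def codens {X : Type u} [NormedAddCommGroup X] [NormedSpace ℝ X]
    (Z : Submodule ℝ X) : Cardinal.{u} :=
  densChar (X ⧸ Z)

/-!
A subfamily `C` of the generating sequence spans a complemented subspace as soon as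
`‖s‖ ≤ r * ‖s + t‖` for `s` in the span of `C` and `t` in the span of the remaining vectors; the
projection then has norm at most `r` (`Splits`, `Splits.exists_projection`). Everything therefore
reduces to finding countable sets of indices that split.

Apply condition (B) to the chain of tails. If the ball hull of the chain lies in the ball of radius
`r`, then each `v` with `‖v‖ > r` has distance at least `1` from some tail. By regularity one tail
serves a countable dense set of such `v` in a separable subspace `S`, and rescaling gives
`‖s‖ ≤ r * ‖s + z‖` for all `s ∈ S` and all `z` in this tail (`exists_norm_le_of_isSeparable`).
Since vectors of a span are finite combinations, any index set of cardinality less than `κ` splits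
from a tail (`exists_splits_Ici`). For (iii), this is applied to a countable set `B` whose closed
span `W` contains `Y`, and `Z` is the sum of `W` and the tail.

Iterating countably often yields initial segments that split from their complements
(`exists_splits_compl`); for `κ = ℵ₁` they are countable, which gives (i). In (ii), with `κ = ℵ_ k`,
such a set has cardinality at most `ℵ_ (k - 1)`. The biorthogonal functionals form a total system,
so any enumeration of a subfamily again has trivially intersecting tails; the set can thus be
enumerated in the order type of its cardinal and split again. After finitely many steps it is
countable, and the constants have been multiplied
(`exists_countable_splits_of_biorthogonal`). Under (1-B) every constant is `1`.
-/

/-- The pair `(C, D)` of index sets *splits* the family `x` with constant `r`: projecting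
`span x(C) + span x(D)` onto the first summand multiplies norms by at most `r`. -/
def Splits {X : Type u} [NormedAddCommGroup X] [NormedSpace ℝ X] {ι : Type*}
    (x : ι → X) (r : ℝ) (C D : Set ι) : Prop :=
  ∀ s ∈ Submodule.span ℝ (x '' C), ∀ t ∈ Submodule.span ℝ (x '' D), ‖s‖ ≤ r * ‖s + t‖

/-- Every null chain of regular uncountable length has ball hull contained in a ball whose radius
lies in `R`. Condition (B) is the case `R = Set.Ici 1`, condition (1-B) the case `R = {1}`. -/
def RadiiIn (R : Set ℝ) (X : Type u) [NormedAddCommGroup X] [NormedSpace ℝ X] : Prop :=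
  ∀ μ : Cardinal.{u}, μ.IsRegular → ℵ₀ < μ →
    ∀ Z : Set.Iio μ.ord → Submodule ℝ X, IsNullChain Z →
      ∃ r ∈ R, ballHull Z ⊆ Metric.closedBall (0 : X) r

/-! ### Splittings of a family and projections -/

section Splitting

variable {X : Type u} [NormedAddCommGroup X] [NormedSpace ℝ X] {ι : Type*} {x : ι → X}

theorem ConditionB.radiiIn (h : ConditionB X) : RadiiIn (Set.Ici 1) X := by
  intro μ hμ hμ' Z hZ
  obtain ⟨r, hr⟩ := (h μ hμ hμ' Z hZ).subset_closedBall 0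
  exact ⟨max 1 r, Set.mem_Ici.2 (le_max_left _ _),
    hr.trans (Metric.closedBall_subset_closedBall (le_max_right _ _))⟩

theorem ConditionRB.radiiIn {r : ℝ} (h : ConditionRB r X) : RadiiIn {r} X :=
  fun μ hμ hμ' Z hZ => ⟨r, rfl, h μ hμ hμ' Z hZ⟩

theorem Splits.mono {r : ℝ} {C C' D D' : Set ι} (h : Splits x r C D) (hC : C' ⊆ C)
    (hD : D' ⊆ D) : Splits x r C' D' := fun s hs t ht =>
  h s (Submodule.span_mono (Set.image_mono hC) hs) t (Submodule.span_mono (Set.image_mono hD) ht)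

/-- Splittings compose: a splitting of all indices into `A` and `Aᶜ`, followed by a splitting of
`A`, is a splitting whose constant is the product. -/
theorem Splits.trans {r r' : ℝ} {A A' C : Set ι} (hr : 0 ≤ r) (hCA : C ⊆ A) (hAA : A ⊆ A')
    (h : Splits x r C (A \ C)) (h' : Splits x r' A (A' \ A)) :
    Splits x (r * r') C (A' \ C) := by
  intro s hs t ht
  have hset : A' \ C = (A \ C) ∪ (A' \ A) := by
    ext i
    have h1 := @hCA i
    have h2 := @hAA i
    simp only [Set.mem_sdiff, Set.mem_union]
    tauto
  rw [hset, Set.image_union, Submodule.span_union] at ht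
  obtain ⟨t₁, ht₁, t₂, ht₂, rfl⟩ := Submodule.mem_sup.1 ht
  have hs' : s + t₁ ∈ Submodule.span ℝ (x '' A) :=
    add_mem (Submodule.span_mono (Set.image_mono hCA) hs)
      (Submodule.span_mono (Set.image_mono Set.sdiff_subset) ht₁)
  calc ‖s‖ ≤ r * ‖s + t₁‖ := h s hs t₁ ht₁
    _ ≤ r * (r' * ‖s + t₁ + t₂‖) := by gcongr; exact h' _ hs' _ ht₂
    _ = r * r' * ‖s + (t₁ + t₂)‖ := by rw [mul_assoc, add_assoc]

theorem Splits.norm_le_of_mem_closedSpan {r : ℝ} {C D : Set ι} (h : Splits x r C D) {s t : X}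
    (hs : s ∈ closedSpan (x '' C)) (ht : t ∈ closedSpan (x '' D)) : ‖s‖ ≤ r * ‖s + t‖ := by
  have hs' : s ∈ closure (Submodule.span ℝ (x '' C) : Set X) := hs
  have ht' : t ∈ closure (Submodule.span ℝ (x '' D) : Set X) := ht
  have hmem : (s, t) ∈ closure
      ((Submodule.span ℝ (x '' C) : Set X) ×ˢ (Submodule.span ℝ (x '' D) : Set X)) := by
    rw [closure_prod_eq]; exact ⟨hs', ht'⟩
  have hcl : IsClosed {p : X × X | ‖p.1‖ ≤ r * ‖p.1 + p.2‖} :=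
    isClosed_le (by fun_prop) (by fun_prop)
  exact closure_minimal (fun p hp => h p.1 hp.1 p.2 hp.2) hcl hmem

theorem subset_closedSpan (A : Set X) : A ⊆ closedSpan A :=
  Submodule.subset_span.trans (Submodule.le_topologicalClosure _)

theorem isClosed_closedSpan (A : Set X) : IsClosed (closedSpan A : Set X) :=
  Submodule.isClosed_topologicalClosure _

theorem closedSpan_mono {A B : Set X} (h : A ⊆ B) : closedSpan A ≤ closedSpan B :=
  Submodule.topologicalClosure_mono (Submodule.span_mono h)

theorem closedSpan_le {A : Set X} {V : Submodule ℝ X} (hV : IsClosed (V : Set X)) (h : A ⊆ V) :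
    closedSpan A ≤ V :=
  Submodule.topologicalClosure_minimal _ (Submodule.span_le.2 h) hV

theorem isSeparable_closedSpan {A : Set X} (hA : A.Countable) :
    TopologicalSpace.IsSeparable (closedSpan A : Set X) :=
  (hA.isSeparable.span (R := ℝ)).closure

theorem exists_finset_mem_span_image {A : Set ι} {v : X} (hv : v ∈ Submodule.span ℝ (x '' A)) :
    ∃ F : Finset A, v ∈ Submodule.span ℝ ((fun i : A => x i) '' F) := by
  classical
  obtain ⟨T, hT, hmem⟩ := Submodule.mem_span_finite_of_mem_span hv
  rw [Set.image_eq_range, ← Set.image_univ] at hT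
  obtain ⟨F, -, rfl⟩ := Finset.subset_set_image_iff.1 hT
  exact ⟨F, by rwa [Finset.coe_image] at hmem⟩

theorem exists_countable_mem_closedSpan {A : Set ι} {v : X} (hv : v ∈ closedSpan (x '' A)) :
    ∃ B ⊆ A, B.Countable ∧ v ∈ closedSpan (x '' B) := by
  have hv' : v ∈ closure (Submodule.span ℝ (x '' A) : Set X) := hv
  obtain ⟨u, hu, hlim⟩ := mem_closure_iff_seq_limit.1 hv'
  choose F hmem using fun n => exists_finset_mem_span_image (hu n)
  refine ⟨⋃ n, (↑) '' (F n : Set A), Set.iUnion_subset fun n => Subtype.coe_image_subset _ _,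
    Set.countable_iUnion fun n => (F n).countable_toSet.image _, ?_⟩
  refine mem_closure_of_tendsto hlim (.of_forall fun n => Submodule.span_mono ?_ (hmem n))
  rintro _ ⟨i, hi, rfl⟩
  exact ⟨i, Set.mem_iUnion.2 ⟨n, i, hi, rfl⟩, rfl⟩

/-- A separable subspace of a closed linear span lies in the closed linear span of countably many
of the generators. -/
theorem exists_countable_le_closedSpan {Y : Submodule ℝ X}
    (hY : TopologicalSpace.IsSeparable (Y : Set X)) (hx : closedSpan (Set.range x) = ⊤) :
    ∃ B : Set ι, B.Countable ∧ Y ≤ closedSpan (x '' B) := by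
  obtain ⟨D, -, hD, hYD⟩ := hY.exists_countable_dense_subset
  have hmem : ∀ v : X, ∃ B : Set ι, B.Countable ∧ v ∈ closedSpan (x '' B) := fun v => by
    obtain ⟨B, -, hB⟩ := exists_countable_mem_closedSpan (x := x) (A := Set.univ) (v := v)
      (by rw [Set.image_univ, hx]; trivial)
    exact ⟨B, hB⟩
  choose B hB hmem using hmem
  refine ⟨⋃ v ∈ D, B v, hD.biUnion fun v _ => hB v, fun y hy => ?_⟩
  refine closure_minimal (fun v hv => ?_) (isClosed_closedSpan _) (hYD hy)
  exact closedSpan_mono (Set.image_mono (Set.subset_biUnion_of_mem hv)) (hmem v)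

/-- If `‖w‖ ≤ r * ‖w + v‖` on closed subspaces `W` and `V`, then `W ⊔ V` is closed and the
projection of `W ⊔ V` onto `W` along `V` has norm at most `r`. -/
theorem exists_projection_of_norm_le [CompleteSpace X] {W V : Submodule ℝ X} {r : ℝ} (hr : 0 ≤ r)
    (hW : IsClosed (W : Set X)) (hV : IsClosed (V : Set X))
    (h : ∀ w ∈ W, ∀ v ∈ V, ‖w‖ ≤ r * ‖w + v‖) :
    IsClosed ((W ⊔ V : Submodule ℝ X) : Set X) ∧
      ∃ P : (W ⊔ V : Submodule ℝ X) →L[ℝ] W,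
        (∀ z : (W ⊔ V : Submodule ℝ X), ∀ hz : (z : X) ∈ W, P z = ⟨z, hz⟩) ∧ ‖P‖ ≤ r := by
  have : CompleteSpace W := hW.completeSpace_coe
  have : CompleteSpace V := hV.completeSpace_coe
  let f : (W × V) →L[ℝ] X := W.subtypeL.coprod V.subtypeL
  have hf : ∀ p, f p = p.1 + p.2 := fun p => by simp [f]
  have hanti : AntilipschitzWith ⟨1 + r, by positivity⟩ f := by
    refine f.antilipschitz_of_bound fun p => ?_
    have h1 : ‖(p.1 : X)‖ ≤ r * ‖f p‖ := by rw [hf]; exact h _ p.1.2 _ p.2.2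
    have h2 : ‖(p.2 : X)‖ ≤ ‖f p‖ + ‖(p.1 : X)‖ := by
      have : (p.2 : X) = f p - p.1 := by rw [hf]; abel
      rw [this]; exact norm_sub_le _ _
    rw [Prod.norm_def]
    change max ‖(p.1 : X)‖ ‖(p.2 : X)‖ ≤ (1 + r) * ‖f p‖
    have h3 := norm_nonneg (f p)
    exact max_le (by linarith) (by linarith)
  have hrange : f.toLinearMap.range = W ⊔ V := by
    simp [f, LinearMap.range_coprod]
  have hclosed : IsClosed ((W ⊔ V : Submodule ℝ X) : Set X) := by
    rw [← hrange]
    exact hanti.isClosed_range f.uniformContinuous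
  refine ⟨hclosed, ?_⟩
  let e := (LinearEquiv.ofInjective f.toLinearMap hanti.injective).trans
    (LinearEquiv.ofEq _ _ hrange)
  have he : ∀ p, (e p : X) = p.1 + p.2 := fun p => hf p
  let P := ((LinearMap.fst ℝ W V).comp e.symm.toLinearMap).mkContinuous r (fun z => by
    obtain ⟨p, rfl⟩ := e.surjective z
    simp only [LinearMap.comp_apply, LinearEquiv.coe_coe, LinearEquiv.symm_apply_apply]
    change ‖(p.1 : X)‖ ≤ r * ‖(e p : X)‖
    rw [he]; exact h _ p.1.2 _ p.2.2)
  refine ⟨P, fun z hz => ?_, LinearMap.mkContinuous_norm_le _ hr _⟩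
  have : e.symm z = (⟨z, hz⟩, 0) := by
    rw [LinearEquiv.symm_apply_eq]
    apply Subtype.ext
    rw [he]; simp
  change (e.symm z).1 = _
  rw [this]

theorem Splits.exists_projection [CompleteSpace X] {r : ℝ} (hr : 0 ≤ r) {C : Set ι}
    (hx : closedSpan (Set.range x) = ⊤) (h : Splits x r C Cᶜ) :
    ∃ P : X →L[ℝ] closedSpan (x '' C), (∀ w : closedSpan (x '' C), P w = w) ∧
      ‖P‖ ≤ r := by
  set W := closedSpan (x '' C)
  set V := closedSpan (x '' Cᶜ)
  obtain ⟨hcl, P, hP, hPr⟩ := exists_projection_of_norm_le hr (isClosed_closedSpan (x '' C))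
    (isClosed_closedSpan (x '' Cᶜ)) fun w hw v hv => h.norm_le_of_mem_closedSpan hw hv
  have htop : W ⊔ V = ⊤ := by
    rw [eq_top_iff, ← hx]
    refine closedSpan_le hcl ?_
    rintro _ ⟨i, rfl⟩
    by_cases hi : i ∈ C
    · exact Submodule.mem_sup_left (subset_closedSpan _ ⟨i, hi, rfl⟩)
    · exact Submodule.mem_sup_right (subset_closedSpan _ ⟨i, hi, rfl⟩)
  let J : X →L[ℝ] (W ⊔ V : Submodule ℝ X) :=
    (ContinuousLinearMap.id ℝ X).codRestrict _ fun v => by rw [htop]; trivial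
  refine ⟨P.comp J, fun w => hP _ w.2, ?_⟩
  refine ContinuousLinearMap.opNorm_le_bound _ hr fun v => ?_
  exact (P.le_opNorm (J v)).trans (by gcongr; exact le_rfl)

end Splitting

/-! ### Splittings along regular cardinals -/

section WellOrder

theorem exists_forall_lt_of_mk_lt {κ : Cardinal.{u}} (hκ : κ.IsRegular) {B : Set κ.ord.ToType}
    (hB : #B < κ) : ∃ a, ∀ b ∈ B, b < a := by
  by_contra! hcon
  refine hB.not_ge ?_
  have := Order.cof_le (s := B) hcon
  rwa [Ordinal.cof_toType, hκ.cof_ord] at this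

theorem mk_finset_lt {α : Type u} {κ : Cardinal.{u}} (hκ : ℵ₀ < κ) (h : #α < κ) :
    #(Finset α) < κ := by
  cases finite_or_infinite α
  · exact (Cardinal.lt_aleph0_of_finite _).trans hκ
  · rwa [Cardinal.mk_finset_of_infinite]

theorem mk_Iio_lt_of_toType_ord {κ : Cardinal.{u}} (i : κ.ord.ToType) : #(Set.Iio i) < κ := by
  simpa using Cardinal.mk_Iio_lt i

variable {X : Type u} [NormedAddCommGroup X] [NormedSpace ℝ X]

/-- A separable subspace is uniformly far from some member of the chain: for each `v` of norm
greater than `r` in a countable dense set some member of the chain has distance at least `1`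
from `v`, and regularity makes one member work for all of these `v`. -/
theorem exists_norm_le_of_isSeparable {κ : Cardinal.{u}} (hκ : κ.IsRegular) (hκ' : ℵ₀ < κ)
    {Z : κ.ord.ToType → Submodule ℝ X} (hZ : Antitone Z) {r : ℝ} (hr : 1 ≤ r)
    (hball : ∀ v, (∀ α, v ∈ closure {v : X | ∃ b ∈ Metric.closedBall (0 : X) 1,
      ∃ z ∈ Z α, v = b + z}) → ‖v‖ ≤ r)
    {S : Submodule ℝ X} (hS : TopologicalSpace.IsSeparable (S : Set X)) :
    ∃ α, ∀ s ∈ S, ∀ z ∈ Z α, ‖s‖ ≤ r * ‖s + z‖ := by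
  obtain ⟨D, hDS, hD, hdense⟩ := (hS.mono (Set.inter_subset_left (s := (S : Set X))
    (t := {s | r < ‖s‖}))).exists_countable_dense_subset
  have hex : ∀ d : D, ∃ α, (d : X) ∉ closure {v : X | ∃ b ∈ Metric.closedBall (0 : X) 1,
      ∃ z ∈ Z α, v = b + z} := by
    intro d
    by_contra! hcon
    exact (hball d hcon).not_gt (hDS d.2).2
  choose a ha using hex
  have := hD.to_subtype
  obtain ⟨α, hα⟩ := exists_forall_lt_of_mk_lt hκ (B := Set.range a)
    (((Set.countable_range a).le_aleph0).trans_lt hκ')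
  have hone : ∀ s ∈ S, r < ‖s‖ → ∀ z ∈ Z α, 1 ≤ ‖s + z‖ := by
    intro s hs hsr z hz
    have hcl : IsClosed {s : X | 1 ≤ ‖s + z‖} := isClosed_le (by fun_prop) (by fun_prop)
    refine closure_minimal (fun d hd => ?_) hcl (hdense ⟨hs, hsr⟩)
    by_contra hlt
    refine ha ⟨d, hd⟩ (subset_closure ⟨d + z, ?_, -z,
      neg_mem (hZ (hα _ ⟨⟨d, hd⟩, rfl⟩).le hz), by abel⟩)
    rw [mem_closedBall_zero_iff]
    exact (not_le.1 hlt).le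
  refine ⟨α, fun s hs z hz => ?_⟩
  by_contra! hlt
  have hq : 0 < ‖s‖ + r * ‖s + z‖ := by
    have := mul_nonneg (zero_le_one.trans hr) (norm_nonneg (s + z))
    linarith
  -- this scalar moves `‖s‖` above `r` while keeping `‖s + z‖` below `1`
  set c := 2 * r / (‖s‖ + r * ‖s + z‖) with hc
  have hr0 : 0 < r := one_pos.trans_le hr
  have hc0 : 0 < c := by positivity
  have h1 := hone (c • s) (S.smul_mem c hs) (by
    rw [norm_smul, Real.norm_of_nonneg hc0.le, hc, div_mul_eq_mul_div, lt_div_iff₀ hq]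
    nlinarith) (c • z) ((Z α).smul_mem c hz)
  rw [← smul_add, norm_smul, Real.norm_of_nonneg hc0.le, hc, div_mul_eq_mul_div,
    le_div_iff₀ hq] at h1
  linarith

/-- The tails of a family with trivially intersecting tails form a null chain, so the hypothesis on
ball hulls yields a radius for it. -/
theorem RadiiIn.exists_radius {R : Set ℝ} (hR : RadiiIn R X) {κ : Cardinal.{u}}
    (hκ : κ.IsRegular) (hκ' : ℵ₀ < κ) {y : κ.ord.ToType → X}
    (hy : ∀ v, (∀ β, v ∈ closedSpan (y '' Set.Ioi β)) → v = 0) :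
    ∃ r ∈ R, ∀ v, (∀ α, v ∈ closure {v : X | ∃ b ∈ Metric.closedBall (0 : X) 1,
      ∃ z ∈ closedSpan (y '' Set.Ioi α), v = b + z}) → ‖v‖ ≤ r := by
  have hnull : IsNullChain
      fun α : Set.Iio κ.ord => closedSpan (y '' Set.Ioi (Ordinal.ToType.mk α)) := by
    refine ⟨fun α β h => closedSpan_mono (Set.image_mono
      (Set.Ioi_subset_Ioi (Ordinal.ToType.mk.monotone h))), fun α => isClosed_closedSpan _, ?_⟩
    rw [eq_bot_iff]
    intro v hv
    rw [Submodule.mem_iInf] at hv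
    refine hy v fun β => ?_
    simpa using hv (Ordinal.ToType.mk.symm β)
  obtain ⟨r, hr, hball⟩ := hR κ hκ hκ' _ hnull
  refine ⟨r, hr, fun v hv => mem_closedBall_zero_iff.1 (hball ?_)⟩
  exact Set.mem_iInter.2 fun α => hv (Ordinal.ToType.mk α)

/-- Every index set of cardinality less than `κ` splits from some tail. Linear combinations have
finite support, so separable (in fact finite-dimensional) subspaces are all that has to be
controlled. -/
theorem exists_splits_Ici {κ : Cardinal.{u}} (hκ : κ.IsRegular) (hκ' : ℵ₀ < κ)
    {y : κ.ord.ToType → X} {r : ℝ} (hr : 1 ≤ r)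
    (hball : ∀ v, (∀ α, v ∈ closure {v : X | ∃ b ∈ Metric.closedBall (0 : X) 1,
      ∃ z ∈ closedSpan (y '' Set.Ioi α), v = b + z}) → ‖v‖ ≤ r)
    {B : Set κ.ord.ToType} (hB : #B < κ) :
    ∃ α, B ⊆ Set.Iio α ∧ Splits y r B (Set.Ici α) := by
  have hex : ∀ F : Finset B, ∃ α, ∀ s ∈ Submodule.span ℝ ((fun i : B => y i) '' F),
      ∀ z ∈ closedSpan (y '' Set.Ioi α), ‖s‖ ≤ r * ‖s + z‖ := fun F =>
    exists_norm_le_of_isSeparable hκ hκ'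
      (fun α β h => closedSpan_mono (Set.image_mono (Set.Ioi_subset_Ioi h))) hr hball
      ((F.finite_toSet.image _).countable.isSeparable.span)
  choose a ha using hex
  obtain ⟨α₁, h₁⟩ := exists_forall_lt_of_mk_lt hκ hB
  obtain ⟨α₂, h₂⟩ := exists_forall_lt_of_mk_lt hκ (B := Set.range a)
    (Cardinal.mk_range_le.trans_lt (mk_finset_lt hκ' hB))
  refine ⟨max α₁ α₂, fun b hb => (h₁ b hb).trans_le (le_max_left _ _), fun s hs t ht => ?_⟩
  obtain ⟨F, hF⟩ := exists_finset_mem_span_image hs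
  refine ha F s hF t (Submodule.le_topologicalClosure _ (Submodule.span_mono
    (Set.image_mono fun i hi => ?_) ht))
  exact (h₂ _ ⟨F, rfl⟩).trans_le ((le_max_right _ _).trans hi)

/-- Iterating `exists_splits_Ici` countably often closes off: every index set of cardinality less
than `κ` is contained in one that splits from its complement. -/
theorem exists_splits_compl {κ : Cardinal.{u}} (hκ : κ.IsRegular) (hκ' : ℵ₀ < κ)
    {y : κ.ord.ToType → X} {r : ℝ} (hr : 1 ≤ r)
    (hball : ∀ v, (∀ α, v ∈ closure {v : X | ∃ b ∈ Metric.closedBall (0 : X) 1,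
      ∃ z ∈ closedSpan (y '' Set.Ioi α), v = b + z}) → ‖v‖ ≤ r)
    {B : Set κ.ord.ToType} (hB : #B < κ) :
    ∃ C, B ⊆ C ∧ #C < κ ∧ Splits y r C Cᶜ := by
  have hstep : ∀ α, ∃ β, Set.Iio α ⊆ Set.Iio β ∧ Splits y r (Set.Iio α) (Set.Ici β) :=
    fun α => exists_splits_Ici hκ hκ' hr hball (mk_Iio_lt_of_toType_ord α)
  choose g hg hsplit using hstep
  obtain ⟨α₀, hα₀⟩ := exists_forall_lt_of_mk_lt hκ hB
  let b : ℕ → κ.ord.ToType := fun n => g^[n] α₀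
  have hb : ∀ n, b (n + 1) = g (b n) := fun n => Function.iterate_succ_apply' g n α₀
  have hmono : Monotone fun n => Set.Iio (b n) :=
    monotone_nat_of_le_succ fun n => by simp only [hb]; exact hg _
  refine ⟨⋃ n, Set.Iio (b n), fun i hi => Set.mem_iUnion.2 ⟨0, hα₀ i hi⟩, ?_, ?_⟩
  · obtain ⟨a, ha⟩ := exists_forall_lt_of_mk_lt hκ (B := Set.range b)
      (((Set.countable_range b).le_aleph0).trans_lt hκ')
    refine (Cardinal.mk_le_mk_of_subset (t := Set.Iio a) ?_).trans_lt (mk_Iio_lt_of_toType_ord a)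
    exact Set.iUnion_subset fun n => Set.Iio_subset_Iio (ha _ ⟨n, rfl⟩).le
  · intro s hs t ht
    rw [Set.image_iUnion, Submodule.span_iUnion,
      Submodule.mem_iSup_of_directed _ (Monotone.directed_le fun m n h =>
        Submodule.span_mono (Set.image_mono (hmono h)))] at hs
    obtain ⟨n, hn⟩ := hs
    refine hsplit (b n) s hn t (Submodule.span_mono (Set.image_mono ?_) ht)
    intro i hi
    rw [← hb]
    exact not_lt.1 fun h => hi (Set.mem_iUnion.2 ⟨n + 1, Set.mem_Iio.2 h⟩)

/-- A total biorthogonal system can be reindexed at will, so the splitting of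
`exists_splits_compl` can be applied along an enumeration of any subset of the index set. Descending
from `ℵ_ k` through the cardinals `ℵ_ j`, `j < k`, every countable index set enlarges to a
countable one that splits. -/
theorem exists_countable_splits_of_biorthogonal {R : Set ℝ} (hR1 : ∀ r ∈ R, 1 ≤ r)
    (hone : (1 : ℝ) ∈ R) (hmul : ∀ r ∈ R, ∀ r' ∈ R, r * r' ∈ R) (hR : RadiiIn R X)
    {ι : Type u} {x : ι → X} {f : ι → StrongDual ℝ X}
    (hf : ∀ i j, i ≠ j → f i (x j) = 0) (htot : ∀ v, (∀ i, f i v = 0) → v = 0) (k : ℕ)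
    {A : Set ι} (hA : #A ≤ ℵ_ (k : Ordinal.{u})) {B : Set ι} (hB : B.Countable) (hBA : B ⊆ A) :
    ∃ C, B ⊆ C ∧ C ⊆ A ∧ C.Countable ∧ ∃ r ∈ R, Splits x r C (A \ C) := by
  induction k generalizing A with
  | zero =>
    refine ⟨A, hBA, subset_rfl, ?_, 1, hone, fun s _ t ht => ?_⟩
    · rwa [Nat.cast_zero, Cardinal.aleph_zero, Cardinal.le_aleph0_iff_set_countable] at hA
    · have : t = 0 := by simpa using ht
      simp [this]
  | succ k ih =>
    rcases le_or_gt #A (ℵ_ (k : Ordinal.{u})) with hle | hlt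
    · exact ih hle hBA
    have hsucc : ℵ_ ((k + 1 : ℕ) : Ordinal.{u}) = Order.succ (ℵ_ (k : Ordinal.{u})) := by
      rw [Nat.cast_succ, Cardinal.succ_aleph]
    set κ := ℵ_ ((k + 1 : ℕ) : Ordinal.{u})
    have hκ : κ.IsRegular := by
      rw [hsucc]; exact Cardinal.isRegular_succ (Cardinal.aleph0_le_aleph _)
    have hκ' : ℵ₀ < κ := by
      rw [hsucc]; exact Order.lt_succ_of_le (Cardinal.aleph0_le_aleph _)
    have hAκ : #A = κ := le_antisymm hA (by rw [hsucc]; exact Order.succ_le_of_lt hlt)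
    obtain ⟨e⟩ : Nonempty (κ.ord.ToType ≃ A) := by
      rw [← Cardinal.eq, hAκ, Cardinal.mk_ord_toType]
    let y : κ.ord.ToType → X := fun α => x (e α)
    have himage : ∀ E : Set κ.ord.ToType, y '' E = x '' ((fun α => (e α : ι)) '' E) := fun E => by
      rw [Set.image_image]
    obtain ⟨r, hr, hball⟩ := hR.exists_radius hκ hκ' (y := y) fun v hv => htot v fun i => by
      -- the tail after `β` is annihilated by `f i` as soon as it avoids the index `i`
      have hker : ∀ β, (∀ γ, β < γ → (e γ : ι) ≠ i) → f i v = 0 := by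
        intro β hβ
        have hcl : IsClosed ((f i).ker : Set X) := (f i).isClosed_ker
        refine closedSpan_le (V := (f i).ker) hcl ?_ (hv β)
        rintro _ ⟨γ, hγ, rfl⟩
        exact hf i _ (hβ γ hγ).symm
      by_cases hi : i ∈ A
      · refine hker (e.symm ⟨i, hi⟩) fun γ hγ h => hγ.ne ?_
        rw [Equiv.symm_apply_eq]; exact Subtype.ext h.symm
      · obtain ⟨β, -⟩ := exists_forall_lt_of_mk_lt hκ (B := (∅ : Set κ.ord.ToType))
          (by simpa using Cardinal.aleph0_pos.trans hκ')
        exact hker β fun γ _ h => hi (h ▸ (e γ).2)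
    let B' : Set κ.ord.ToType := (fun α => (e α : ι)) ⁻¹' B
    have hB' : B'.Countable := hB.preimage (Subtype.val_injective.comp e.injective)
    obtain ⟨C', hBC', hC', hsplit⟩ := exists_splits_compl hκ hκ' (hR1 r hr) hball
      (hB'.le_aleph0.trans_lt hκ')
    set A' : Set ι := (fun α => (e α : ι)) '' C'
    have hA'A : A' ⊆ A := by rintro _ ⟨α, -, rfl⟩; exact (e α).2
    have hBA' : B ⊆ A' := fun i hi =>
      ⟨e.symm ⟨i, hBA hi⟩, hBC' (by simpa [B'] using hi), by simp⟩
    have hA' : #A' ≤ ℵ_ (k : Ordinal.{u}) := by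
      have hC'' := hC'.trans_eq hsucc
      exact Cardinal.mk_image_le.trans (Order.lt_succ_iff.1 hC'')
    have hsplit' : Splits x r A' (A \ A') := by
      intro s hs t ht
      refine hsplit s (by rwa [himage]) t ?_
      rw [himage]
      refine Submodule.span_mono (Set.image_mono ?_) ht
      rintro i ⟨hi, hi'⟩
      exact ⟨e.symm ⟨i, hi⟩, fun h => hi' ⟨_, h, by simp⟩, by simp⟩
    obtain ⟨C, hBC, hCA', hC, r', hr', hsp⟩ := ih hA' hBA'
    exact ⟨C, hBC, hCA'.trans hA'A, hC, r' * r, hmul _ hr' _ hr,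
      hsp.trans (zero_le_one.trans (hR1 _ hr')) hCA' hA'A hsplit'⟩

end WellOrder

/-! ### Subsequences, density characters, totality -/

section Subsequences

variable {X : Type u} [NormedAddCommGroup X] [NormedSpace ℝ X]

/-- Any subfamily of a well-ordered family, enumerated increasingly, is a subsequence. -/
theorem isGeneratedBySubseq_closedSpan_image {o : Ordinal.{u}} (x : Set.Iio o → X)
    (C : Set o.ToType) :
    IsGeneratedBySubseq x (closedSpan ((fun α => x (Ordinal.ToType.mk.symm α)) '' C)) := by
  obtain ⟨e⟩ : Nonempty ((Ordinal.type (α := C) (· < ·)).ToType ≃o C) := by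
    have h := Ordinal.type_toType (Ordinal.type (α := C) (· < ·))
    obtain ⟨e⟩ := Ordinal.type_eq.1 h
    exact ⟨OrderIso.ofRelIsoLT e⟩
  let e' := Ordinal.ToType.mk.trans e
  refine ⟨_, fun σ => Ordinal.ToType.mk.symm (e' σ), fun σ τ h =>
    Ordinal.ToType.mk.symm.strictMono (e'.strictMono h), ?_⟩
  congr 1
  ext v
  constructor
  · rintro ⟨i, hi, rfl⟩
    exact ⟨e'.symm ⟨i, hi⟩, by simp⟩
  · rintro ⟨σ, rfl⟩
    exact ⟨e' σ, (e' σ).2, rfl⟩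

theorem densChar_le {T : Type u} [TopologicalSpace T] {s : Set T} (hs : Dense s) :
    densChar T ≤ #s :=
  csInf_le' ⟨s, hs, rfl⟩

/-- The span of at most `c` vectors has density at most `c`: the spans of the finite subfamilies
are separable, and there are at most `c` of them. -/
theorem exists_span_le_closure {ι : Type u} (x : ι → X) {c : Cardinal.{u}} (hc : ℵ₀ ≤ c)
    {B : Set ι} (hB : #B ≤ c) :
    ∃ D : Set X, #D ≤ c ∧ (Submodule.span ℝ (x '' B) : Set X) ⊆ closure D := by
  have hex : ∀ F : Finset B, ∃ D : Set X, D.Countable ∧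
      (Submodule.span ℝ ((fun i : B => x i) '' F) : Set X) ⊆ closure D := fun F =>
    (F.finite_toSet.image _).countable.isSeparable.span (R := ℝ)
  choose D hD hcl using hex
  refine ⟨⋃ F, D F, ?_, fun v hv => ?_⟩
  · have hfin : #(Finset B) ≤ c := by
      cases finite_or_infinite B
      · exact (Cardinal.lt_aleph0_of_finite _).le.trans hc
      · rwa [Cardinal.mk_finset_of_infinite]
    refine (Cardinal.mk_iUnion_le_sum_mk).trans ((Cardinal.sum_le_mk_mul_iSup _).trans ?_)
    refine (mul_le_mul' hfin (ciSup_le' fun F => (hD F).le_aleph0.trans hc)).trans ?_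
    rw [Cardinal.mul_eq_self hc]
  · obtain ⟨F, hF⟩ := exists_finset_mem_span_image hv
    exact closure_mono (Set.subset_iUnion D F) (hcl F hF)

/-- If a generating family lies in `Z` except for at most `c` of its members, then `X / Z` has
density character at most `c`. -/
theorem codens_le {ι : Type u} {x : ι → X} (hx : closedSpan (Set.range x) = ⊤)
    {c : Cardinal.{u}} (hc : ℵ₀ ≤ c) {B : Set ι} (hB : #B ≤ c) {Z : Submodule ℝ X}
    (hZ : ∀ i ∉ B, x i ∈ Z) : codens Z ≤ c := by
  obtain ⟨D, hD, hcl⟩ := exists_span_le_closure x hc hB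
  refine (densChar_le (s := Z.mkQ '' D) ?_).trans (Cardinal.mk_image_le.trans hD)
  have hcont : Continuous Z.mkQ := continuous_quot_mk
  have hspan : Z.mkQ '' (Submodule.span ℝ (Set.range x)) ⊆ closure (Z.mkQ '' D) := by
    rintro _ ⟨v, hv, rfl⟩
    have hv' : v ∈ Submodule.span ℝ (x '' B) ⊔ Z := by
      refine Submodule.span_le.2 ?_ hv
      rintro _ ⟨i, rfl⟩
      by_cases hi : i ∈ B
      · exact Submodule.mem_sup_left (Submodule.subset_span ⟨i, hi, rfl⟩)
      · exact Submodule.mem_sup_right (hZ i hi)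
    obtain ⟨s, hs, z, hz, rfl⟩ := Submodule.mem_sup.1 hv'
    rw [map_add, (Submodule.mkQ_apply Z z).trans ((Submodule.Quotient.mk_eq_zero Z).2 hz), add_zero]
    exact image_closure_subset_closure_image hcont ⟨s, hcl hs, rfl⟩
  have hdense : Dense (Submodule.span ℝ (Set.range x) : Set X) := by
    intro v
    have : v ∈ closedSpan (Set.range x) := by rw [hx]; trivial
    exact this
  have := Z.mkQ_surjective.denseRange.dense_image hcont hdense
  exact dense_closure.1 (this.mono hspan)

theorem eq_zero_of_topologicalClosure_span_eq_top {o : Ordinal.{u}} {f : Set.Iio o → StrongDual ℝ X}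
    (hf : (Submodule.span ℝ
      (Set.range fun α => StrongDual.toWeakDual (f α))).topologicalClosure = ⊤)
    {v : X} (hv : ∀ α, f α v = 0) : v = 0 := by
  refine SeparatingDual.eq_zero_of_forall_dual_eq_zero (R := ℝ) fun g => ?_
  let ev : WeakDual ℝ X →ₗ[ℝ] ℝ :=
    { toFun := fun g => g v, map_add' := fun _ _ => rfl, map_smul' := fun _ _ => rfl }
  have hcl : IsClosed (ev.ker : Set (WeakDual ℝ X)) :=
    isClosed_singleton.preimage (WeakDual.eval_continuous v)
  have hle : (Submodule.span ℝ
      (Set.range fun α => StrongDual.toWeakDual (f α))).topologicalClosure ≤ ev.ker := by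
    refine Submodule.topologicalClosure_minimal _ (Submodule.span_le.2 ?_) hcl
    rintro _ ⟨α, rfl⟩
    exact hv α
  have hg : StrongDual.toWeakDual g ∈ ev.ker := hle (by rw [hf]; trivial)
  exact hg

end Subsequences

/-! ### Separable complementation -/

section SeparableComplementation

variable {X : Type u} [NormedAddCommGroup X] [NormedSpace ℝ X] {o : Ordinal.{u}}
  {x : Set.Iio o → X}

theorem HasSCPVia.hasSCP (h : HasSCPVia x) : HasSCP X := fun Y hY =>
  let ⟨W, hYW, hW, hc, _⟩ := h Y hY
  ⟨W, hYW, hW, hc⟩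

theorem HasOneSCPVia.hasOneSCP (h : HasOneSCPVia x) : HasOneSCP X := fun Y hY =>
  let ⟨W, hYW, hW, hc, _⟩ := h Y hY
  ⟨W, hYW, hW, hc⟩

/-- If every countable index set enlarges to a countable one that splits from its complement, then
separable subspaces enlarge to spans of subsequences that are ranges of projections. -/
theorem exists_projection_of_forall_countable_splits [CompleteSpace X] (hx : IsGenerating x)
    {R : Set ℝ} (hR : ∀ r ∈ R, 1 ≤ r)
    (h : ∀ B : Set o.ToType, B.Countable → ∃ C, B ⊆ C ∧ C.Countable ∧
      ∃ r ∈ R, Splits (fun α => x (Ordinal.ToType.mk.symm α)) r C Cᶜ)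
    {Y : Submodule ℝ X} (hY : TopologicalSpace.IsSeparable (Y : Set X)) :
    ∃ W : Submodule ℝ X, Y ≤ W ∧ TopologicalSpace.IsSeparable (W : Set X) ∧
      (∃ r ∈ R, ∃ P : X →L[ℝ] W, (∀ w : W, P w = w) ∧ ‖P‖ ≤ r) ∧ IsGeneratedBySubseq x W := by
  have hx' : closedSpan (Set.range fun α => x (Ordinal.ToType.mk.symm α)) = ⊤ := by
    rw [← hx]
    exact congrArg closedSpan (Ordinal.ToType.mk.symm.surjective.range_comp x)
  obtain ⟨B, hB, hYB⟩ := exists_countable_le_closedSpan hY hx'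
  obtain ⟨C, hBC, hC, r, hr, hsplit⟩ := h B hB
  exact ⟨_, hYB.trans (closedSpan_mono (Set.image_mono hBC)), isSeparable_closedSpan (hC.image _),
    ⟨r, hr, hsplit.exists_projection (zero_le_one.trans (hR r hr)) hx'⟩,
    isGeneratedBySubseq_closedSpan_image x C⟩

theorem hasSCPVia_of_forall_countable_splits [CompleteSpace X] (hx : IsGenerating x)
    (h : ∀ B : Set o.ToType, B.Countable → ∃ C, B ⊆ C ∧ C.Countable ∧
      ∃ r ∈ Set.Ici (1 : ℝ), Splits (fun α => x (Ordinal.ToType.mk.symm α)) r C Cᶜ) :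
    HasSCPVia x := by
  intro Y hY
  obtain ⟨W, hYW, hW, ⟨r, -, P, hP, -⟩, hs⟩ :=
    exists_projection_of_forall_countable_splits hx (fun _ h => h) h hY
  exact ⟨W, hYW, hW, ⟨P, hP⟩, hs⟩

theorem hasOneSCPVia_of_forall_countable_splits [CompleteSpace X] (hx : IsGenerating x)
    (h : ∀ B : Set o.ToType, B.Countable → ∃ C, B ⊆ C ∧ C.Countable ∧
      ∃ r ∈ ({1} : Set ℝ), Splits (fun α => x (Ordinal.ToType.mk.symm α)) r C Cᶜ) :
    HasOneSCPVia x := by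
  intro Y hY
  obtain ⟨W, hYW, hW, ⟨r, rfl, P, hP, hPr⟩, hs⟩ :=
    exists_projection_of_forall_countable_splits hx (fun _ h => h.ge) h hY
  exact ⟨W, hYW, hW, ⟨P, hP, hPr⟩, hs⟩

theorem IsStronglyDispersed.eq_zero (hx : IsStronglyDispersed x) {v : X}
    (hv : ∀ β, v ∈ closedSpan ((fun α => x (Ordinal.ToType.mk.symm α)) '' Set.Ioi β)) : v = 0 := by
  have : v ∈ ⨅ γ, tailSpan x γ := by
    rw [Submodule.mem_iInf]
    intro γ
    refine closedSpan_mono ?_ (hv (Ordinal.ToType.mk γ))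
    rintro _ ⟨α, hα, rfl⟩
    exact ⟨_, Set.mem_Ioi.2 ((OrderIso.lt_symm_apply _).2 hα), rfl⟩
  rw [hx.2] at this
  simpa using this

end SeparableComplementation

theorem theorem3p4 {X : Type u} [NormedAddCommGroup X] [NormedSpace ℝ X] [CompleteSpace X]
    (hB : ConditionB X)
    (κ : Cardinal.{u}) (hκ : κ.IsRegular) (hκ_unc : ℵ₀ < κ)
    (x : Set.Iio κ.ord → X) (hgen : IsGenerating x) (hSD : IsStronglyDispersed x) :
    -- (i)
    (κ = ℵ₁ →
      (HasSCP X ∧ HasSCPVia x) ∧ (ConditionRB 1 X → HasOneSCP X ∧ HasOneSCPVia x)) ∧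
    -- (ii)
    (κ < ℵ_ Ordinal.omega0 → IsMBasis x →
      (HasSCP X ∧ HasSCPVia x) ∧ (ConditionRB 1 X → HasOneSCP X ∧ HasOneSCPVia x)) ∧
    -- (iii)
    (∀ k : ℕ, 0 < k → κ = ℵ_ (k : Ordinal.{u}) →
      ∀ Y : Submodule ℝ X, TopologicalSpace.IsSeparable (Y : Set X) →
        ∃ Z W : Submodule ℝ X,
          IsClosed (Z : Set X) ∧ codens Z ≤ ℵ_ ((k - 1 : ℕ) : Ordinal.{u}) ∧
          IsClosed (W : Set X) ∧ TopologicalSpace.IsSeparable (W : Set X) ∧ Y ≤ W ∧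
          IsComplementedIn W Z ∧ IsGeneratedBySubseq x W) := by
  have main : (∀ R : Set ℝ, (∀ r ∈ R, 1 ≤ r) → (1 : ℝ) ∈ R →
      (∀ r ∈ R, ∀ r' ∈ R, r * r' ∈ R) → RadiiIn R X →
        ∀ B : Set κ.ord.ToType, B.Countable → ∃ C, B ⊆ C ∧ C.Countable ∧
          ∃ r ∈ R, Splits (fun α => x (Ordinal.ToType.mk.symm α)) r C Cᶜ) →
      (HasSCP X ∧ HasSCPVia x) ∧ (ConditionRB 1 X → HasOneSCP X ∧ HasOneSCPVia x) := by
    intro h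
    have h1 := hasSCPVia_of_forall_countable_splits hgen (h (Set.Ici 1) (fun _ h => h)
      (Set.mem_Ici.2 le_rfl) (fun r hr r' hr' =>
        Set.mem_Ici.2 (one_le_mul_of_one_le_of_one_le hr hr')) hB.radiiIn)
    refine ⟨⟨h1.hasSCP, h1⟩, fun hRB => ?_⟩
    have h2 := hasOneSCPVia_of_forall_countable_splits hgen (h {1} (fun _ h => h.ge) rfl
      (by simp) hRB.radiiIn)
    exact ⟨h2.hasOneSCP, h2⟩
  refine ⟨fun hκ1 => main fun R hR1 _ _ hR B hB => ?_, fun hκω hMB => main ?_, ?_⟩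
  · obtain ⟨r, hr, hball⟩ := hR.exists_radius hκ hκ_unc fun v => hSD.eq_zero (v := v)
    obtain ⟨C, hBC, hC, hs⟩ := exists_splits_compl hκ hκ_unc (hR1 r hr) hball
      (hB.le_aleph0.trans_lt hκ_unc)
    refine ⟨C, hBC, ?_, r, hr, hs⟩
    rwa [← Cardinal.le_aleph0_iff_set_countable, ← Order.lt_succ_iff, Cardinal.succ_aleph0, ← hκ1]
  · intro R hR1 hone hmul hR B hB
    obtain ⟨k, hk⟩ : ∃ k : ℕ, κ = ℵ_ (k : Ordinal.{u}) := by
      obtain ⟨a, rfl⟩ := Cardinal.mem_range_aleph_iff.2 hκ_unc.le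
      obtain ⟨k, rfl⟩ := Ordinal.lt_omega0.1 (Cardinal.aleph_lt_aleph.1 hκω)
      exact ⟨k, rfl⟩
    obtain ⟨-, f, -, hf, htot⟩ := hMB
    obtain ⟨C, hBC, -, hC, r, hr, hs⟩ := exists_countable_splits_of_biorthogonal hR1 hone hmul hR
      (x := fun α => x (Ordinal.ToType.mk.symm α)) (f := fun α => f (Ordinal.ToType.mk.symm α))
      (fun i j hij => hf _ _ (Ordinal.ToType.mk.symm.injective.ne hij))
      (fun v hv => eq_zero_of_topologicalClosure_span_eq_top htot fun α => by
        simpa using hv (Ordinal.ToType.mk α)) k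
      (A := Set.univ) (by rw [Cardinal.mk_univ, Cardinal.mk_ord_toType, hk]) hB
      (Set.subset_univ B)
    exact ⟨C, hBC, hC, r, hr, by rwa [Set.compl_eq_univ_sdiff]⟩
  · intro k hk hκk Y hY
    set y : κ.ord.ToType → X := fun α => x (Ordinal.ToType.mk.symm α)
    have hgen' : closedSpan (Set.range y) = ⊤ := by
      rw [← hgen]
      exact congrArg closedSpan (Ordinal.ToType.mk.symm.surjective.range_comp x)
    obtain ⟨B, hBc, hYB⟩ := exists_countable_le_closedSpan hY hgen'
    obtain ⟨r, hr, hball⟩ := hB.radiiIn.exists_radius hκ hκ_unc fun v => hSD.eq_zero (v := v)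
    obtain ⟨α, -, hs⟩ := exists_splits_Ici hκ hκ_unc hr hball (hBc.le_aleph0.trans_lt hκ_unc)
    obtain ⟨hZ, P, hP, -⟩ := exists_projection_of_norm_le (zero_le_one.trans hr)
      (isClosed_closedSpan (y '' B)) (isClosed_closedSpan (y '' Set.Ici α))
      fun w hw v hv => hs.norm_le_of_mem_closedSpan hw hv
    refine ⟨closedSpan (y '' B) ⊔ closedSpan (y '' Set.Ici α), closedSpan (y '' B), hZ, ?_,
      isClosed_closedSpan _, isSeparable_closedSpan (hBc.image _), hYB, ⟨le_sup_left, ?_⟩,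
      isGeneratedBySubseq_closedSpan_image x B⟩
    · refine codens_le hgen' (Cardinal.aleph0_le_aleph _) (B := Set.Iio α) ?_ fun i hi =>
        Submodule.mem_sup_right (subset_closedSpan _ ⟨i, Set.mem_Ici.2 (not_lt.1 hi), rfl⟩)
      rw [← Order.lt_succ_iff, Cardinal.succ_aleph, ← Nat.cast_succ, Nat.succ_eq_add_one,
        Nat.sub_add_cancel hk, ← hκk]
      exact mk_Iio_lt_of_toType_ord α
    · let J : closedSpan (y '' B) →L[ℝ] (closedSpan (y '' B)).submoduleOf
          (closedSpan (y '' B) ⊔ closedSpan (y '' Set.Ici α)) :=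
        ((closedSpan (y '' B)).subtypeL.codRestrict _ fun w =>
          Submodule.mem_sup_left w.2).codRestrict _ fun w => w.2
      refine ⟨J.comp P, fun w => ?_⟩
      apply Subtype.ext
      apply Subtype.ext
      change (P w : X) = w
      rw [hP w w.2]
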